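/- Work with deterministic multi-tape (multi-stack) Turing machines with finite alphabets. A language $L\subseteq\{0,1\}^*$ is in $\mathrm{PSPACE}$ if some such machine decides it and uses, on every input $q$, space at most $s(|q|)$ for a polynomial $s$. A judge is a function $H$ that assigns a bit to every question $q\in\{0,1\}^*$ and finite list of statements $x_0,x_1,\dots\in\{0,1\}^*$; it is a polynomial-time judge if it is computed in time polynomial in the length of the word $q\#x_0\#x_1\cdots$. In the debate game on $q$ with $n$ steps, statement length bound $m$ and judge $H$, Alice and Bob alternately choose statements $x_0,\dots,x_{n-1}\in\{0,1\}^{\le m}$, each depending on the earlier ones; Alice chooses $x_0,x_2,\dots$ and Bob chooses $x_1,x_3,\dots$. Alice wins if $H(q,x_0,\dots,x_{n-1})=1$, and otherwise Bob wins. Optimal play is an equilibrium of this zero-sum game: a pair of strategies such that neither player can turn a loss into a win by changing only their own strategy. **Theorem.** For every language $L\in\mathrm{PSPACE}$ there are a polynomial-time judge $H$ and polynomials $n,m$ with natural number coefficients, with $n(k)$ odd for every $k\in\mathbb N$, such that for every $q\in\{0,1\}^*$, writing $n=n(|q|)$ and letting all $x_i$ range over $\{0,1\}^{\le m(|q|)}$,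 $$q\in L\iff \exists x_0\,\forall x_1\,\exists x_2\cdots\exists x_{n-1}.\; H(q,x_0,\dots,x_{n-1})=1 .$$ Moreover, for every $q$, optimal play in the debate game on $q$ with $n(|q|)$ steps, statement length bound $m(|q|)$ and judge $H$ exists, and under every optimal play the judge's verdict is $1$ if and only if $q\in L$. -/

import Mathlib

namespace Debate

open Turing StateTransition Computability

/-! ### Polynomial space -/

/-- The space used by a configuration of a multi-stack Turing machine: the total number of symbols
on all its stacks, the input stack included. -/
def cfgSpace (tm : FinTM2) (c : tm.Cfg) : ℕ :=
  letI := tm.kFin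
  ∑ k : tm.K, (TM2.Cfg.stk c k).length

/-- `L ∈ PSPACE`: some Turing machine with finite stack alphabets halts on every input `q`, with
output the bit saying whether `q ∈ L`, and every configuration that it visits on the input `q` uses
space at most `s(|q|)`, for a polynomial `s`. -/
def InPSPACE (L : Language Bool) : Prop :=
  ∃ (f : List Bool → Bool) (M : TM2Computable (fun q : List Bool => q) encodeBool f)
    (s : Polynomial ℕ),
    (∀ k, Finite (M.tm.Γ k)) ∧
    (∀ q, f q = true ↔ q ∈ L) ∧
    ∀ (q : List Bool) (c : M.tm.Cfg),
      Reaches M.tm.step (initList M.tm (q.map M.inputAlphabet.invFun)) c →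
        cfgSpace M.tm c ≤ s.eval q.length

/-! ### Polynomial time judges -/

/-- A question `q` with statements `x₀, x₁, …` written as the word `q # x₀ # x₁ …`; the
separator `#` is the symbol `none`. -/
def encodeTranscript (t : List Bool × List (List Bool)) : List (Option Bool) :=
  t.1.map some ++ t.2.flatMap fun x => none :: x.map some

/-- The judge `H`, a function of a question and a list of statements, is computed by a Turing
machine with finite stack alphabets in time polynomial in the length of its input. -/
def IsPolyTimeJudge (H : List Bool → List (List Bool) → Bool) : Prop :=
  ∃ M : TM2ComputableInPolyTime encodeTranscript encodeBool
      (fun t : List Bool × List (List Bool) => H t.1 t.2),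
    ∀ k, Finite (M.tm.Γ k)

/-! ### The debate game -/

/-- A statement in a debate: a bit string of length at most `m`. -/
abbrev Move (m : ℕ) : Type := {x : List Bool // x.length ≤ m}

/-- `Alternating true n P` is `∃ x₀, ∀ x₁, ∃ x₂, …, P [x₀, …, xₙ₋₁]` with `n` quantifiers, and
`Alternating false n P` is `∀ x₀, ∃ x₁, ∀ x₂, …, P [x₀, …, xₙ₋₁]`. -/
def Alternating {α : Type} : Bool → ℕ → (List α → Prop) → Prop
  | _, 0, P => P []
  | true, n + 1, P => ∃ x, Alternating false n fun l => P (x :: l)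
  | false, n + 1, P => ∀ x, Alternating true n fun l => P (x :: l)

/-- The verdict of the judge `H` on the question `q` after the debate `l`; `true` means that Alice
wins and `false` that Bob wins. -/
def verdict (H : List Bool → List (List Bool) → Bool) (q : List Bool) {m : ℕ}
    (l : List (Move m)) : Bool :=
  H q (l.map Subtype.val)

/-- A strategy chooses the next statement, given all the statements made so far. -/
abbrev Strategy (m : ℕ) : Type := List (Move m) → Move m

/-- The first `i` statements of the debate in which Alice plays `σ` and makes the statements
`x₀, x₂, …`, and Bob plays `τ` and makes the statements `x₁, x₃, …`. -/
def play {m : ℕ} (σ τ : Strategy m) : ℕ → List (Move m)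
  | 0 => []
  | i + 1 => play σ τ i ++ [if Even i then σ (play σ τ i) else τ (play σ τ i)]

/-- Optimal play in the zero-sum debate game with `n` statements on the question `q`: the pair
`(σ, τ)` is an equilibrium, i.e. neither Alice nor Bob can turn a loss into a win by changing her or
his own strategy. -/
def IsOptimalPlay (H : List Bool → List (List Bool) → Bool) (q : List Bool) (n : ℕ) {m : ℕ}
    (σ τ : Strategy m) : Prop :=
  (∀ σ' : Strategy m,
    verdict H q (play σ' τ n) = true → verdict H q (play σ τ n) = true) ∧
  (∀ τ' : Strategy m,
    verdict H q (play σ τ' n) = false → verdict H q (play σ τ n) = false)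

end Debate

namespace Debate

open Turing StateTransition Computability

/-! ### One step of a machine as a map on stacks -/

section Points

variable (tm : FinTM2)

/-! A halting deterministic machine never repeats a configuration before it halts, so in polynomial
space it halts within `2^(m+1)` steps, where `m` bounds the bit strings describing its
configurations (`iterate_step_eq_of_evalsTo`). Alice claims that the accepting configuration is the
`2^(m+1)`-th iterate of the initial one. In each round she names the configuration halfway, and the
last bit of Bob's answer selects the half on which the debate continues. After `m+1` rounds the
claim concerns a single step, which the judge checks.

A true claim has a midpoint that makes both halves true (`alternating_of_iterate_eq`); conversely,
two true halves compose to a true claim (`iterate_eq_of_alternating`). The second direction needs no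
control over what Alice writes: every bit string decodes to a `Point`, and `pointStep` is a total
map on points. The space bound serves to fit the true midpoints into statements and to bound the
running time.

The endpoints of the current interval are the latest statements answered by `true` (left) and by
`false` (right), or else the initial and the accepting configuration. A judge that reads the
transcript backwards finds them as the first block with each mark; `LoadsAs` expresses this, and
`reaches_judgeHalt` gives linear time. The claim on optimal play is determinacy of finite games. -/

/-- The alphabets of the stacks describing a configuration of `tm`: the additional stack `none`
holds the label and the internal state. -/
abbrev PointSymbol : Option tm.K → Type
  | none => Option tm.Λ × tm.σ
  | some k => tm.Γ k

/-- Stack contents describing a configuration of `tm`. -/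
abbrev Point : Type := ∀ k, List (PointSymbol tm k)

/-- A symbol together with the stack it lies on. -/
abbrev Item : Type := Σ k, PointSymbol tm k

variable {tm}

/-- The point with header stack `t` and the stacks `S` of `tm`. -/
def Point.mk (t : List (Option tm.Λ × tm.σ)) (S : ∀ k, List (tm.Γ k)) : Point tm
  | none => t
  | some k => S k

/-- The point describing a configuration. -/
def toPoint (c : tm.Cfg) : Point tm :=
  Point.mk [(TM2.Cfg.l c, TM2.Cfg.var c)] (TM2.Cfg.stk c)

/-- Push an item on its stack. -/
def pushItem (a : Item tm) (X : Point tm) : Point tm :=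
  Function.update X a.1 (a.2 :: X a.1)

/-- Push all items of a list, the last one first. -/
def pushItems (l : List (Item tm)) (X : Point tm) : Point tm :=
  l.foldr pushItem X

/-- The point described by a list of items. -/
def ofItems (l : List (Item tm)) : Point tm :=
  pushItems l fun _ => []

/-- One step of `tm`, as a map on points. -/
def pointStep (X : Point tm) : Point tm :=
  match X none with
  | (some l, v) :: t =>
    let c := TM2.stepAux (tm.m l) v fun k => X (some k)
    Point.mk ((c.l, c.var) :: t) c.stk
  | _ => X

theorem Point.mk_eta (X : Point tm) : Point.mk (X none) (fun k => X (some k)) = X := by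
  funext k; cases k <;> rfl

theorem toPoint_injective : Function.Injective (toPoint (tm := tm)) := by
  rintro ⟨l, v, S⟩ ⟨l', v', S'⟩ h
  have h0 := congrFun h none
  have h1 : S = S' := funext fun k => congrFun h (some k)
  simp only [toPoint, Point.mk, List.cons.injEq, Prod.mk.injEq, and_true] at h0
  obtain ⟨rfl, rfl⟩ := h0
  subst h1
  rfl

/-- A halted configuration stays put on both sides, so the partial step function becomes a total map
that can be iterated past the halting time. -/
theorem pointStep_toPoint (c : tm.Cfg) : pointStep (toPoint c) = toPoint ((tm.step c).getD c) := by
  rcases c with ⟨_ | l, v, S⟩ <;> rfl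

/-- Popping inverts pushing; this lets the judge compare a list of items with a point one item at a
time. -/
theorem pushItem_eq_iff (a : Item tm) (X Y : Point tm) :
    pushItem a X = Y ↔ (Y a.1).head? = some a.2 ∧ X = Function.update Y a.1 (Y a.1).tail := by
  constructor
  · rintro rfl
    simp [pushItem]
  · rintro ⟨h, rfl⟩
    obtain ⟨t, ht⟩ := List.head?_eq_some_iff.1 h
    simp only [pushItem, Function.update_self, Function.update_idem]
    rw [ht, List.tail_cons, ← ht, Function.update_eq_self]

end Points

/-! ### The judge as a machine -/

section Machine

variable (tm : FinTM2)

/-- The stacks of the judge: input, output, parsed transcript, second configuration, and the stacks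
on which one step of `tm` is simulated. -/
inductive JudgeStack
  | inp
  | out
  | rev
  | hi
  | sim (k : Option tm.K)

/-- Symbols of the parsed transcript: items, and marks, each of which follows the block of items
to which it belongs. -/
abbrev Token : Type := Item tm ⊕ Bool

/-- The alphabets of the judge. -/
abbrev JudgeSymbol : JudgeStack tm → Type
  | .inp => Option Bool
  | .out => Bool
  | .rev => Token tm
  | .hi => Item tm
  | .sim k => PointSymbol tm k

/-- The states of the parser: inside the question, inside a statement of Alice after a number of
bits `true`, or inside a statement of Bob with given last bit. -/
inductive ParseState
  | question
  | alice (j : Fin (Nat.card (Item tm)))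
  | bob (b : Bool)

/-- The state of the loader: whether the blocks marked `true` and `false` have been found, and the
mark of the block that is being loaded. -/
abbrev LoadState : Type := (Bool × Bool) × Option Bool

/-- The control states of the judge. -/
inductive JudgeState
  | start
  | parse (f : ParseState tm)
  | emit (s : Token tm) (f : ParseState tm)
  | load (g : LoadState)
  | store (b : Bool) (a : Item tm) (g : LoadState)
  | simulate
  | run (l : tm.Λ) (v : tm.σ)
  | var (v : tm.σ)
  | put (p : Option tm.Λ × tm.σ)
  | compare
  | compareItem (a : Item tm)
  | clean (b : Bool)
  | done (b : Bool)

variable {tm}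

theorem finite_pointSymbol [∀ k, Finite (tm.Γ k)] (k : Option tm.K) :
    Finite (PointSymbol tm k) := by
  have := tm.ΛFin
  have := tm.σFin
  cases k <;> simp only [PointSymbol] <;> infer_instance

instance [∀ k, Finite (tm.Γ k)] : Finite (Item tm) := by
  have := tm.kFin
  have := finite_pointSymbol (tm := tm)
  infer_instance

instance : Nonempty (Item tm) := ⟨⟨none, (none, tm.initialState)⟩⟩

instance [∀ k, Finite (tm.Γ k)] : NeZero (Nat.card (Item tm)) := ⟨Nat.card_pos.ne'⟩

instance : Finite (JudgeStack tm) := by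
  have := tm.kFin
  refine Finite.of_surjective (α := Fin 4 ⊕ Option tm.K)
    (Sum.elim ![.inp, .out, .rev, .hi] .sim) ?_
  rintro (_ | _ | _ | _ | k)
  exacts [⟨.inl 0, rfl⟩, ⟨.inl 1, rfl⟩, ⟨.inl 2, rfl⟩, ⟨.inl 3, rfl⟩, ⟨.inr k, rfl⟩]

noncomputable instance : DecidableEq (JudgeStack tm) := Classical.decEq _

instance : Finite (ParseState tm) := by
  refine Finite.of_surjective (α := Unit ⊕ Fin (Nat.card (Item tm)) ⊕ Bool)
    (Sum.elim (fun _ => .question) (Sum.elim .alice .bob)) ?_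
  rintro (_ | j | b)
  exacts [⟨.inl (), rfl⟩, ⟨.inr (.inl j), rfl⟩, ⟨.inr (.inr b), rfl⟩]

instance [∀ k, Finite (tm.Γ k)] : Finite (JudgeState tm) := by
  have := tm.ΛFin
  have := tm.σFin
  let f : Fin 3 ⊕ ParseState tm ⊕ (Token tm × ParseState tm) ⊕ LoadState ⊕
      (Bool × Item tm × LoadState) ⊕ (tm.Λ × tm.σ) ⊕ tm.σ ⊕ (Option tm.Λ × tm.σ) ⊕ Item tm ⊕
      Bool ⊕ Bool → JudgeState tm
    | .inl i => ![.start, .simulate, .compare] i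
    | .inr (.inl f) => .parse f
    | .inr (.inr (.inl p)) => .emit p.1 p.2
    | .inr (.inr (.inr (.inl g))) => .load g
    | .inr (.inr (.inr (.inr (.inl p)))) => .store p.1 p.2.1 p.2.2
    | .inr (.inr (.inr (.inr (.inr (.inl p))))) => .run p.1 p.2
    | .inr (.inr (.inr (.inr (.inr (.inr (.inl v)))))) => .var v
    | .inr (.inr (.inr (.inr (.inr (.inr (.inr (.inl p))))))) => .put p
    | .inr (.inr (.inr (.inr (.inr (.inr (.inr (.inr (.inl a)))))))) => .compareItem a
    | .inr (.inr (.inr (.inr (.inr (.inr (.inr (.inr (.inr (.inl b))))))))) => .clean b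
    | .inr (.inr (.inr (.inr (.inr (.inr (.inr (.inr (.inr (.inr b))))))))) => .done b
  refine Finite.of_surjective f ?_
  rintro (_ | f | ⟨s, f⟩ | g | ⟨b, a, g⟩ | _ | ⟨l, v⟩ | v | p | _ | a | b | b)
  exacts [⟨.inl 0, rfl⟩, ⟨.inr (.inl f), rfl⟩, ⟨.inr (.inr (.inl (s, f))), rfl⟩,
    ⟨.inr (.inr (.inr (.inl g))), rfl⟩, ⟨.inr (.inr (.inr (.inr (.inl (b, a, g))))), rfl⟩,
    ⟨.inl 1, rfl⟩, ⟨.inr (.inr (.inr (.inr (.inr (.inl (l, v)))))), rfl⟩,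
    ⟨.inr (.inr (.inr (.inr (.inr (.inr (.inl v)))))), rfl⟩,
    ⟨.inr (.inr (.inr (.inr (.inr (.inr (.inr (.inl p))))))), rfl⟩, ⟨.inl 2, rfl⟩,
    ⟨.inr (.inr (.inr (.inr (.inr (.inr (.inr (.inr (.inl a)))))))), rfl⟩,
    ⟨.inr (.inr (.inr (.inr (.inr (.inr (.inr (.inr (.inr (.inl b))))))))), rfl⟩,
    ⟨.inr (.inr (.inr (.inr (.inr (.inr (.inr (.inr (.inr (.inr b))))))))), rfl⟩]

/-- The state of `tm` kept in a control state of the judge during the simulation. -/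
def JudgeState.getVar : JudgeState tm → tm.σ
  | .var v => v
  | _ => tm.initialState

/-- Statements of the judge. -/
abbrev JudgeStmt (tm : FinTM2) : Type :=
  TM2.Stmt (JudgeSymbol tm) (JudgeState tm) (JudgeState tm)

/-- Jump to the label stored in the internal state. -/
abbrev jump : JudgeStmt tm := TM2.Stmt.goto id

/-- A statement of `tm`, carried out on the simulation stacks. -/
def liftStmt : TM2.Stmt tm.Γ tm.Λ tm.σ → JudgeStmt tm
  | .push k f s => .push (.sim (some k)) (fun q => f q.getVar) (liftStmt s)
  | .peek k f s => .peek (.sim (some k)) (fun q o => .var (f q.getVar o)) (liftStmt s)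
  | .pop k f s => .pop (.sim (some k)) (fun q o => .var (f q.getVar o)) (liftStmt s)
  | .load f s => .load (fun q => .var (f q.getVar)) (liftStmt s)
  | .branch f s t => .branch (fun q => f q.getVar) (liftStmt s) (liftStmt t)
  | .goto f => .load (fun q => .put (some (f q.getVar), q.getVar)) jump
  | .halt => .load (fun q => .put (none, q.getVar)) jump

/-- The transitions of the parser, with the token that is written. -/
noncomputable def parseStep [∀ k, Finite (tm.Γ k)] (inj : Bool → tm.Γ tm.k₀) :
    ParseState tm → Option Bool → ParseState tm × Option (Token tm)
  | .question, some b => (.question, some (.inl ⟨some tm.k₀, inj b⟩))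
  | .question, none => (.alice 0, some (.inr true))
  | .alice j, some true => (.alice (j + 1), none)
  | .alice j, some false => (.alice 0, some (.inl ((Finite.equivFin (Item tm)).symm j)))
  -- No mark is written yet: Alice's block is marked by Bob's answer, at the separator that ends it.
  -- An empty answer counts as `false`.
  | .alice _, none => (.bob false, none)
  | .bob _, some b => (.bob b, none)
  | .bob b, none => (.alice 0, some (.inr b))

/-- The effect of a mark on the state of the loader. -/
def LoadState.mark (g : LoadState) : Bool → LoadState
  | true => if g.1.1 then (g.1, none) else ((true, g.1.2), some true)
  | false => if g.1.2 then (g.1, none) else ((g.1.1, true), some false)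

/-- Pop every stack of a list; if one of them is not empty, then go to `clean false`. -/
def popAll (l : List (JudgeStack tm)) : JudgeStmt tm :=
  l.foldr (fun k s => .pop k (fun q o => if o.isSome then .clean false else q) s) jump

/-- The header of the initial configuration. -/
def initItem (tm : FinTM2) : Item tm := ⟨none, (some tm.main, tm.initialState)⟩

/-- The items of the accepting configuration. -/
def acceptItems (yes : tm.Γ tm.k₁) : List (Item tm) :=
  [⟨none, (none, tm.initialState)⟩, ⟨some tm.k₁, yes⟩]

open Classical in
/-- The program of the judge. -/
noncomputable def judgeProgram [∀ k, Finite (tm.Γ k)] (inj : Bool → tm.Γ tm.k₀)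
    (yes : tm.Γ tm.k₁) : JudgeState tm → JudgeStmt tm
  | .start =>
    .push .rev (fun _ => .inl ⟨none, (none, tm.initialState)⟩) <|
    .push .rev (fun _ => .inl ⟨some tm.k₁, yes⟩) <|
    .push .rev (fun _ => .inr false) <|
    .push .rev (fun _ => .inl (initItem tm)) <|
    .load (fun _ => .parse .question) jump
  | .parse f => .pop .inp (fun _ o => match o with
      | none => .load ((false, false), none)
      | some c => match parseStep inj f c with
        | (f', none) => .parse f'
        | (f', some s) => .emit s f') jump
  | .emit s f => .push .rev (fun _ => s) <| .load (fun _ => .parse f) jump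
  | .load g => .pop .rev (fun _ o => match o with
      | none => .simulate
      | some (.inr b) => .load (g.mark b)
      | some (.inl a) => match g.2 with
        | none => .load g
        | some b => .store b a g) jump
  | .store true a g => .push (.sim a.1) (fun _ => a.2) <| .load (fun _ => .load g) jump
  | .store false a g => .push .hi (fun _ => a) <| .load (fun _ => .load g) jump
  | .simulate => .pop (.sim none) (fun _ o => match o with
      | none => .compare
      | some (some l, v) => .run l v
      | some (none, v) => .put (none, v)) jump
  | .run l v => .load (fun _ => .var v) (liftStmt (tm.m l))
  | .var _ => .halt
  | .put p => .push (.sim none) (fun _ => p) <| .load (fun _ => .compare) jump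
  | .compare => .pop .hi (fun _ o => match o with
      | none => .clean true
      | some a => .compareItem a) jump
  | .compareItem a => .pop (.sim a.1)
      (fun _ o => if o = some a.2 then .compare else .clean false) jump
  | .clean b => .load (fun _ => .done b)
      (popAll (@Finset.univ _ (Fintype.ofFinite (JudgeStack tm))).toList)
  | .done b => .push .out (fun _ => b) <| .load (fun _ => .start) .halt

/-- The judge. -/
noncomputable def judgeTM [∀ k, Finite (tm.Γ k)] (inj : Bool → tm.Γ tm.k₀)
    (yes : tm.Γ tm.k₁) : FinTM2 where
  K := JudgeStack tm
  kFin := Fintype.ofFinite _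
  k₀ := .inp
  k₁ := .out
  Γ := JudgeSymbol tm
  Λ := JudgeState tm
  main := .start
  ΛFin := Fintype.ofFinite _
  σ := JudgeState tm
  initialState := .start
  σFin := Fintype.ofFinite _
  Γk₀Fin := inferInstanceAs (Fintype (Option Bool))
  m := judgeProgram inj yes

end Machine

/-! ### Runs of bounded length. -/

section Runs

/-- `b` is reached from `a` in at most `t` steps of `f`. -/
def ReachesWithin {α : Type*} (f : α → Option α) (t : ℕ) (a b : α) : Prop :=
  ∃ n ≤ t, (flip bind f)^[n] (some a) = some b

variable {α : Type*} {f : α → Option α} {a b c : α} {s t : ℕ}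

theorem ReachesWithin.refl (f : α → Option α) (t : ℕ) (a : α) : ReachesWithin f t a a :=
  ⟨0, Nat.zero_le _, rfl⟩

theorem ReachesWithin.trans (h₁ : ReachesWithin f s a b) (h₂ : ReachesWithin f t b c) :
    ReachesWithin f (s + t) a c := by
  obtain ⟨n, hn, h⟩ := h₁
  obtain ⟨k, hk, h'⟩ := h₂
  exact ⟨k + n, by omega, by rw [Function.iterate_add_apply, h, h']⟩

theorem ReachesWithin.mono (h : ReachesWithin f s a b) (hst : s ≤ t) : ReachesWithin f t a b := by
  obtain ⟨n, hn, h⟩ := h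
  exact ⟨n, hn.trans hst, h⟩

theorem ReachesWithin.head (h₁ : f a = some b) (h₂ : ReachesWithin f t b c) :
    ReachesWithin f (t + 1) a c := by
  obtain ⟨n, hn, h⟩ := h₂
  refine ⟨n + 1, by omega, ?_⟩
  rw [Function.iterate_succ_apply]
  simpa [flip, h₁] using h

end Runs

/-! ### Correctness and running time of the judge's program. -/

section Semantics

variable {tm : FinTM2}

/-- The stacks of the judge, with empty output. -/
def judgeStacks (i : List (Option Bool)) (r : List (Token tm)) (h : List (Item tm))
    (X : Point tm) : ∀ k, List (JudgeSymbol tm k)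
  | .inp => i
  | .out => []
  | .rev => r
  | .hi => h
  | .sim k => X k

variable {i : List (Option Bool)} {r : List (Token tm)} {h : List (Item tm)} {X : Point tm}

theorem update_inp (l : List (Option Bool)) :
    Function.update (judgeStacks i r h X) .inp l = judgeStacks l r h X := by
  funext k
  cases k <;> first | rw [Function.update_self]; rfl | (rw [Function.update_of_ne (by simp)]; rfl)

theorem update_rev (l : List (Token tm)) :
    Function.update (judgeStacks i r h X) .rev l = judgeStacks i l h X := by
  funext k
  cases k <;> first | rw [Function.update_self]; rfl | (rw [Function.update_of_ne (by simp)]; rfl)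

theorem update_hi (l : List (Item tm)) :
    Function.update (judgeStacks i r h X) .hi l = judgeStacks i r l X := by
  funext k
  cases k <;> first | rw [Function.update_self]; rfl | (rw [Function.update_of_ne (by simp)]; rfl)

theorem update_sim (k : Option tm.K) (l : List (PointSymbol tm k)) :
    Function.update (judgeStacks i r h X) (.sim k) l =
      judgeStacks i r h (Function.update X k l) := by
  funext k'
  rcases k' with _ | _ | _ | _ | k'
  case sim =>
    by_cases hk : k' = k
    · subst hk
      rw [Function.update_self]
      exact (Function.update_self (β := fun k => List (PointSymbol tm k)) ..).symm
    · rw [Function.update_of_ne (by simpa using hk)]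
      exact (Function.update_of_ne (β := fun k => List (PointSymbol tm k)) hk ..).symm
  all_goals rw [Function.update_of_ne (by simp)]; rfl

theorem update_mk_some (t : List (Option tm.Λ × tm.σ)) (S : ∀ k, List (tm.Γ k)) (k : tm.K)
    (l : List (tm.Γ k)) :
    Function.update (Point.mk t S) (some k) l = Point.mk t (Function.update S k l) := by
  funext k'
  rcases k' with _ | k'
  · rw [Function.update_of_ne (by simp)]; rfl
  · by_cases hk : k' = k
    · subst hk
      rw [Function.update_self]
      exact (Function.update_self (β := fun k => List (tm.Γ k)) ..).symm
    · rw [Function.update_of_ne (by simpa using hk)]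
      exact (Function.update_of_ne (β := fun k => List (tm.Γ k)) hk ..).symm

theorem update_mk_none (t t' : List (Option tm.Λ × tm.σ)) (S : ∀ k, List (tm.Γ k)) :
    Function.update (Point.mk t S) none t' = Point.mk t' S := by
  funext k'
  rcases k' with _ | k'
  · rw [Function.update_self]; rfl
  · rw [Function.update_of_ne (by simp)]; rfl

/-- A running configuration of the judge. -/
def judgeCfg (q : JudgeState tm) (i : List (Option Bool)) (r : List (Token tm))
    (h : List (Item tm)) (X : Point tm) : TM2.Cfg (JudgeSymbol tm) (JudgeState tm) (JudgeState tm) :=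
  ⟨some q, q, judgeStacks i r h X⟩

/-- The stacks of the judge at the end. -/
def outStacks (b : Bool) : ∀ k, List (JudgeSymbol tm k)
  | .inp => []
  | .out => [b]
  | .rev => []
  | .hi => []
  | .sim _ => []

/-- The final configuration of the judge. -/
def judgeHalt (b : Bool) : TM2.Cfg (JudgeSymbol tm) (JudgeState tm) (JudgeState tm) :=
  ⟨none, .start, outStacks b⟩

/-- A whole statement of `tm` runs inside one step of the judge. The new label and state are kept in
the control state `put`, to be written back to the header afterwards. -/
theorem stepAux_liftStmt (s : TM2.Stmt tm.Γ tm.Λ tm.σ) (v : tm.σ)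
    (t : List (Option tm.Λ × tm.σ)) (S : ∀ k, List (tm.Γ k)) :
    TM2.stepAux (liftStmt s) (.var v) (judgeStacks i r h (Point.mk t S)) =
      judgeCfg (.put ((TM2.stepAux s v S).l, (TM2.stepAux s v S).var)) i r h
        (Point.mk t (TM2.stepAux s v S).stk) := by
  induction s generalizing v S with
  | push k f s ih =>
    simp only [liftStmt, TM2.stepAux]
    rw [update_sim, ← ih, ← update_mk_some]; rfl
  | peek k f s ih => exact ih _ _
  | pop k f s ih =>
    simp only [liftStmt, TM2.stepAux]
    rw [update_sim, ← ih, ← update_mk_some]; rfl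
  | load f s ih => exact ih _ _
  | branch f s t ihs iht =>
    simp only [liftStmt, TM2.stepAux]
    rw [show (JudgeState.var v).getVar = v from rfl]
    cases f v
    · exact iht _ _
    · exact ihs _ _
  | goto f => rfl
  | halt => rfl

/-- The number of symbols that a statement may push. -/
def pushCount : TM2.Stmt tm.Γ tm.Λ tm.σ → ℕ
  | .push _ _ s => pushCount s + 1
  | .peek _ _ s => pushCount s
  | .pop _ _ s => pushCount s
  | .load _ s => pushCount s
  | .branch _ s t => pushCount s + pushCount t
  | .goto _ => 0
  | .halt => 0

/-- Stack heights matter because the final clean-up takes time proportional to them. Adding the two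
counts of a branch is crude but still a constant of the machine. -/
theorem length_stepAux_le (s : TM2.Stmt tm.Γ tm.Λ tm.σ) (v : tm.σ) (S : ∀ k, List (tm.Γ k))
    (k : tm.K) : ((TM2.stepAux s v S).stk k).length ≤ (S k).length + pushCount s := by
  induction s generalizing v S with
  | push k' f s ih =>
    refine (ih _ _).trans ?_
    by_cases hk : k = k'
    · subst hk; simp only [Function.update_self, List.length_cons, pushCount]; omega
    · rw [Function.update_of_ne hk]; simp only [pushCount]; omega
  | peek k' f s ih => exact ih _ _
  | pop k' f s ih =>
    refine (ih _ _).trans ?_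
    by_cases hk : k = k'
    · subst hk; simp [pushCount]
    · rw [Function.update_of_ne hk]; simp [pushCount]
  | load f s ih => exact ih _ _
  | branch f s t ihs iht =>
    simp only [TM2.stepAux, pushCount]
    cases f v
    · exact (iht _ _).trans (by omega)
    · exact (ihs _ _).trans (by omega)
  | goto f => simp [pushCount]
  | halt => simp [pushCount]

/-- A bound for the number of symbols pushed in one step of `tm`. -/
def maxPush (tm : FinTM2) : ℕ :=
  letI := tm.ΛFin
  ∑ l, pushCount (tm.m l)

theorem length_pointStep_le (X : Point tm) (k : Option tm.K) :
    (pointStep X k).length ≤ (X k).length + maxPush tm := by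
  let _ := tm.ΛFin
  rcases hX : X none with _ | ⟨⟨_ | l, v⟩, t⟩
  · simp [pointStep, hX]
  · simp [pointStep, hX]
  · simp only [pointStep, hX]
    cases k with
    | none => simp [Point.mk, hX]
    | some k =>
      refine (length_stepAux_le (tm.m l) v (fun k => X (some k)) k).trans ?_
      exact Nat.add_le_add_left
        (Finset.single_le_sum (f := fun l => pushCount (tm.m l)) (by simp) (Finset.mem_univ l)) _

/-- The contents of the simulation stacks and of the stack `hi` after loading. -/
def loadOut : LoadState → List (Token tm) → Point tm → List (Item tm) → Point tm × List (Item tm)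
  | _, [], X, h => (X, h)
  | g, .inr b :: r, X, h => loadOut (g.mark b) r X h
  | (p, none), .inl _ :: r, X, h => loadOut (p, none) r X h
  | (p, some true), .inl a :: r, X, h => loadOut (p, some true) r (pushItem a X) h
  | (p, some false), .inl a :: r, X, h => loadOut (p, some false) r X (a :: h)

/-- The tokens written at the start. -/
def startTokens (yes : tm.Γ tm.k₁) : List (Token tm) :=
  [.inl (initItem tm), .inr false, .inl ⟨some tm.k₁, yes⟩, .inl ⟨none, (none, tm.initialState)⟩]

open Classical in
/-- The verdict on a parsed transcript. -/
noncomputable def tokenVerdict (r : List (Token tm)) : Bool :=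
  decide (ofItems (loadOut ((false, false), none) r (fun _ => []) []).2 =
    pointStep (loadOut ((false, false), none) r (fun _ => []) []).1)

theorem length_pushItem_le (a : Item tm) (X : Point tm) (k : Option tm.K) :
    (pushItem a X k).length ≤ (X k).length + 1 := by
  by_cases hk : k = a.1
  · subst hk; simp [pushItem]
  · simp [pushItem, Function.update_of_ne hk]

theorem length_loadOut_le (g : LoadState) (r : List (Token tm)) (X : Point tm)
    (h : List (Item tm)) :
    (∀ k, ((loadOut g r X h).1 k).length ≤ (X k).length + r.length) ∧
      (loadOut g r X h).2.length ≤ h.length + r.length := by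
  induction r generalizing g X h with
  | nil => simp [loadOut]
  | cons s r ih =>
    rcases s with a | b
    · rcases g with ⟨p, _ | _ | _⟩
      · obtain ⟨h₁, h₂⟩ := ih (p, none) X h
        exact ⟨fun k => (h₁ k).trans (by simp), h₂.trans (by simp)⟩
      · obtain ⟨h₁, h₂⟩ := ih (p, some false) X (a :: h)
        exact ⟨fun k => (h₁ k).trans (by simp), h₂.trans (by simp; omega)⟩
      · obtain ⟨h₁, h₂⟩ := ih (p, some true) (pushItem a X) h
        refine ⟨fun k => (h₁ k).trans ?_, h₂.trans (by simp)⟩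
        have := length_pushItem_le a X k
        simp; omega
    · obtain ⟨h₁, h₂⟩ := ih (g.mark b) X h
      rw [show loadOut g (.inr b :: r) X h = loadOut (g.mark b) r X h by simp [loadOut]]
      exact ⟨fun k => (h₁ k).trans (by simp), h₂.trans (by simp)⟩

-- Without repetitions each stack is popped once, so every emptiness test sees the original
-- contents.
open Classical in
theorem stepAux_popAll (l : List (JudgeStack tm)) (hl : l.Nodup) (q : JudgeState tm)
    (S : ∀ k, List (JudgeSymbol tm k)) :
    TM2.stepAux (popAll l) q S =
      ⟨some (if ∀ k ∈ l, S k = [] then q else .clean false),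
        if ∀ k ∈ l, S k = [] then q else .clean false,
        fun k => if k ∈ l then (S k).tail else S k⟩ := by
  induction l generalizing q S with
  | nil => simp [popAll]
  | cons k l ih =>
    obtain ⟨hk, hl⟩ := List.nodup_cons.1 hl
    have hS : ∀ k' ∈ l, Function.update S k (S k).tail k' = S k' := fun k' hk' =>
      Function.update_of_ne (by rintro rfl; exact hk hk') ..
    have h₁ : (∀ k' ∈ l, Function.update S k (S k).tail k' = []) ↔ ∀ k' ∈ l, S k' = [] :=
      forall₂_congr fun k' hk' => by rw [hS k' hk']
    have h₂ : (fun k' => if k' ∈ l then (Function.update S k (S k).tail k').tail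
        else Function.update S k (S k).tail k') =
        fun k' => if k' ∈ k :: l then (S k').tail else S k' := by
      funext k'
      by_cases hk' : k' ∈ l
      · simp [hk', hS k' hk']
      · by_cases h : k' = k
        · subst h; simp [hk']
        · simp [hk', h]
    change TM2.stepAux (popAll l) (if (S k).head?.isSome then .clean false else q)
      (Function.update S k (S k).tail) = _
    rw [ih hl, h₂]
    simp only [h₁]
    rcases hk : S k with _ | ⟨x, t⟩ <;> simp [hk]

variable [∀ k, Finite (tm.Γ k)] (inj : Bool → tm.Γ tm.k₀) (yes : tm.Γ tm.k₁)

/-- The tokens written by the parser, on top of the stack `r`. -/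
noncomputable def parseOut : ParseState tm → List (Option Bool) → List (Token tm) → List (Token tm)
  | _, [], r => r
  | f, c :: i, r => parseOut (parseStep inj f c).1 i ((parseStep inj f c).2.toList ++ r)

theorem length_parseOut_le (f : ParseState tm) (i : List (Option Bool)) (r : List (Token tm)) :
    (parseOut inj f i r).length ≤ i.length + r.length := by
  induction i generalizing f r with
  | nil => simp [parseOut]
  | cons c i ih =>
    refine (ih _ _).trans ?_
    cases (parseStep inj f c).2 <;> simp; omega

theorem reaches_parse (f : ParseState tm) (i : List (Option Bool)) (r : List (Token tm))
    (h : List (Item tm)) (X : Point tm) :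
    ReachesWithin (TM2.step (judgeProgram inj yes)) (2 * i.length + 1)
      (judgeCfg (.parse f) i r h X)
      (judgeCfg (.load ((false, false), none)) [] (parseOut inj f i r) h X) := by
  induction i generalizing f r with
  | nil =>
    refine .head (b := judgeCfg (.load ((false, false), none)) [] r h X) ?_ (.refl ..)
    simp only [judgeCfg, TM2.step, judgeProgram, TM2.stepAux, update_inp]
    rfl
  | cons c i ih =>
    rw [parseOut]
    rcases hf : parseStep inj f c with ⟨f', _ | s⟩
    · refine ReachesWithin.mono (.head (b := judgeCfg (.parse f') i r h X) ?_ (ih f' r))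
        (by simp only [List.length_cons]; omega)
      simp only [judgeCfg, TM2.step, judgeProgram, TM2.stepAux, update_inp]
      simp only [judgeStacks, List.head?_cons, hf]
      rfl
    · refine ReachesWithin.mono (.head (b := judgeCfg (.emit s f') i r h X) ?_
        (.head (b := judgeCfg (.parse f') i (s :: r) h X) ?_ (ih f' (s :: r))))
        (by simp only [List.length_cons]; omega)
      · simp only [judgeCfg, TM2.step, judgeProgram, TM2.stepAux, update_inp]
        simp only [judgeStacks, List.head?_cons, hf]
        rfl
      · simp only [judgeCfg, TM2.step, judgeProgram, TM2.stepAux, update_rev]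
        rfl

theorem reaches_load (g : LoadState) (r : List (Token tm)) (h : List (Item tm)) (X : Point tm) :
    ReachesWithin (TM2.step (judgeProgram inj yes)) (2 * r.length + 1)
      (judgeCfg (.load g) [] r h X)
      (judgeCfg .simulate [] [] (loadOut g r X h).2 (loadOut g r X h).1) := by
  induction r generalizing g X h with
  | nil =>
    rw [loadOut]
    refine .head (b := judgeCfg .simulate [] [] h X) ?_ (.refl ..)
    simp only [judgeCfg, TM2.step, judgeProgram, TM2.stepAux, update_rev]
    rfl
  | cons s r ih =>
    rcases s with a | b
    · rcases g with ⟨p, _ | _ | _⟩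
      · rw [loadOut]
        refine ReachesWithin.mono (.head (b := judgeCfg (.load (p, none)) [] r h X) ?_ (ih ..))
          (by simp only [List.length_cons]; omega)
        simp only [judgeCfg, TM2.step, judgeProgram, TM2.stepAux, update_rev]
        rfl
      · rw [loadOut]
        refine ReachesWithin.mono
          (.head (b := judgeCfg (.store false a (p, some false)) [] r h X) ?_
          (.head (b := judgeCfg (.load (p, some false)) [] r (a :: h) X) ?_ (ih ..)))
          (by simp only [List.length_cons]; omega)
        · simp only [judgeCfg, TM2.step, judgeProgram, TM2.stepAux, update_rev]
          rfl
        · simp only [judgeCfg, TM2.step, judgeProgram, TM2.stepAux, update_hi]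
          rfl
      · rw [loadOut]
        refine ReachesWithin.mono
          (.head (b := judgeCfg (.store true a (p, some true)) [] r h X) ?_
          (.head (b := judgeCfg (.load (p, some true)) [] r h (pushItem a X)) ?_ (ih ..)))
          (by simp only [List.length_cons]; omega)
        · simp only [judgeCfg, TM2.step, judgeProgram, TM2.stepAux, update_rev]
          rfl
        · simp only [judgeCfg, TM2.step, judgeProgram, TM2.stepAux, update_sim]
          rfl
    · rw [show loadOut g (.inr b :: r) X h = loadOut (g.mark b) r X h by simp [loadOut]]
      refine ReachesWithin.mono (.head (b := judgeCfg (.load (g.mark b)) [] r h X) ?_ (ih ..))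
        (by simp only [List.length_cons]; omega)
      simp only [judgeCfg, TM2.step, judgeProgram, TM2.stepAux, update_rev]
      rfl

/-- The header is popped, the statement is run, and the new header is pushed. Points with an empty
header stack or a halted label must come out unchanged, as under `pointStep`. -/
theorem reaches_simulate (h : List (Item tm)) (X : Point tm) :
    ReachesWithin (TM2.step (judgeProgram inj yes)) 3
      (judgeCfg .simulate [] [] h X) (judgeCfg .compare [] [] h (pointStep X)) := by
  have hpop (q : JudgeState tm) (hq : (match (X none).head? with
      | none => JudgeState.compare
      | some (some l, v) => .run l v
      | some (none, v) => .put (none, v)) = q) :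
      TM2.step (judgeProgram inj yes) (judgeCfg .simulate [] [] h X) =
        some (judgeCfg q [] [] h (Point.mk (X none).tail fun k => X (some k))) := by
    rw [← update_mk_none (X none), Point.mk_eta]
    subst hq
    simp only [judgeCfg, TM2.step, judgeProgram, TM2.stepAux, update_sim]
    rfl
  have hput (p t) (S : ∀ k, List (tm.Γ k)) :
      TM2.step (judgeProgram inj yes) (judgeCfg (.put p) [] [] h (Point.mk t S)) =
        some (judgeCfg .compare [] [] h (Point.mk (p :: t) S)) := by
    rw [← update_mk_none t (p :: t)]
    simp only [judgeCfg, TM2.step, judgeProgram, TM2.stepAux, update_sim]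
    rfl
  rcases hX : X none with _ | ⟨⟨_ | l, v⟩, t⟩
  · have h₁ := hpop .compare (by rw [hX]; rfl)
    rw [hX, List.tail_nil, ← hX, Point.mk_eta] at h₁
    rw [show pointStep X = X by simp [pointStep, hX]]
    exact .head h₁ (.refl ..)
  · have h₁ := hpop (.put (none, v)) (by rw [hX]; rfl)
    rw [show pointStep X = X by simp [pointStep, hX]]
    refine .head h₁ (.head (hput ..) ?_)
    rw [hX, List.tail_cons, ← hX, Point.mk_eta]
    exact .refl ..
  · have h₁ := hpop (.run l v) (by rw [hX]; rfl)
    rw [hX, List.tail_cons] at h₁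
    have h₂ : TM2.step (judgeProgram inj yes)
        (judgeCfg (.run l v) [] [] h (Point.mk t fun k => X (some k))) = some _ :=
      congrArg some (stepAux_liftStmt (tm.m l) v t fun k => X (some k))
    simpa only [pointStep, hX] using .head h₁ (.head h₂ (.head (hput ..) (.refl _ 0 _)))

-- Testing for emptiness and emptying are the same loop: `done b` survives a pass only if there was
-- nothing to pop.
open Classical in
theorem step_clean (S : ∀ k, List (JudgeSymbol tm k)) (b : Bool) :
    TM2.step (judgeProgram inj yes) ⟨some (.clean b), .clean b, S⟩ =
      some ⟨some (if ∀ k, S k = [] then .done b else .clean false),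
        if ∀ k, S k = [] then .done b else .clean false, fun k => (S k).tail⟩ := by
  refine congrArg some ((stepAux_popAll _ (Finset.nodup_toList _) _ _).trans ?_)
  simp

open Classical in
theorem reaches_clean_of_empty {S : ∀ k, List (JudgeSymbol tm k)} (b : Bool)
    (hS : ∀ k, S k = []) :
    ReachesWithin (TM2.step (judgeProgram inj yes)) 2 ⟨some (.clean b), .clean b, S⟩
      (judgeHalt (b && decide (∀ k, S k = []))) := by
  have h := step_clean inj yes S b
  rw [if_pos hS] at h
  rw [decide_eq_true hS, Bool.and_true]
  refine .head h (.head ?_ (.refl ..))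
  simp only [TM2.step, judgeProgram, TM2.stepAux, judgeHalt]
  congr 2
  funext k
  cases k
  case out => rw [Function.update_self]; simp [hS, outStacks]
  all_goals rw [Function.update_of_ne (by simp)]; simp [hS, outStacks]

open Classical in
theorem reaches_clean (B : ℕ) (S : ∀ k, List (JudgeSymbol tm k)) (hS : ∀ k, (S k).length ≤ B)
    (b : Bool) :
    ReachesWithin (TM2.step (judgeProgram inj yes)) (B + 2) ⟨some (.clean b), .clean b, S⟩
      (judgeHalt (b && decide (∀ k, S k = []))) := by
  induction B generalizing S b with
  | zero =>
    have h : ∀ k, S k = [] := fun k => List.length_eq_zero_iff.1 (Nat.le_zero.1 (hS k))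
    exact reaches_clean_of_empty inj yes b h
  | succ B ih =>
    by_cases h : ∀ k, S k = []
    · exact (reaches_clean_of_empty inj yes b h).mono (by omega)
    · have := step_clean inj yes S b
      rw [if_neg h] at this
      have h' := ReachesWithin.head this (ih _ (fun k => by
        have := hS k
        rw [List.length_tail]
        omega) false)
      -- Some stack is nonempty, so the verdict is `false` whatever `b` was.
      rwa [Bool.false_and, ← Bool.and_false b, ← decide_eq_false h] at h'

-- Once the list of items is used up, equality means that the remaining point is empty, which is
-- what `clean true` tests.
open Classical in
theorem reaches_compare (B : ℕ) (h : List (Item tm)) (X : Point tm) (hh : h.length ≤ B)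
    (hX : ∀ k, (X k).length ≤ B) :
    ReachesWithin (TM2.step (judgeProgram inj yes)) (2 * h.length + 1 + (B + 2))
      (judgeCfg .compare [] [] h X) (judgeHalt (decide (ofItems h = X))) := by
  have hB (h : List (Item tm)) (X : Point tm) (hh : h.length ≤ B) (hX : ∀ k, (X k).length ≤ B)
      (k : JudgeStack tm) : (judgeStacks [] [] h X k).length ≤ B := by
    cases k
    case hi => exact hh
    case sim k => exact hX k
    all_goals exact Nat.zero_le _
  induction h generalizing X with
  | nil =>
    have h₁ : ofItems [] = X ↔ ∀ k, judgeStacks [] [] [] X k = [] := by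
      constructor
      · rintro rfl (_ | _ | _ | _ | k) <;> rfl
      · intro h
        exact funext fun k => (h (.sim k)).symm
    have h₂ := reaches_clean inj yes B _ (hB [] X hh hX) true
    simp only [← h₁, Bool.true_and] at h₂
    refine (ReachesWithin.head (b := judgeCfg (.clean true) [] [] [] X) ?_ h₂).mono
      (by simp only [List.length_nil]; omega)
    simp only [judgeCfg, TM2.step, judgeProgram, TM2.stepAux, update_hi]
    rfl
  | cons a h ih =>
    have h₁ : TM2.step (judgeProgram inj yes) (judgeCfg .compare [] [] (a :: h) X) =
        some (judgeCfg (.compareItem a) [] [] h X) := by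
      simp only [judgeCfg, TM2.step, judgeProgram, TM2.stepAux, update_hi]
      rfl
    have h₂ : TM2.step (judgeProgram inj yes) (judgeCfg (.compareItem a) [] [] h X) =
        some (judgeCfg (if (X a.1).head? = some a.2 then .compare else .clean false) [] [] h
          (Function.update X a.1 (X a.1).tail)) := by
      simp only [judgeCfg, TM2.step, judgeProgram, TM2.stepAux, update_sim]
      rfl
    have h₃ : ofItems (a :: h) = X ↔ (X a.1).head? = some a.2 ∧
        ofItems h = Function.update X a.1 (X a.1).tail := pushItem_eq_iff a (ofItems h) X
    have hlen : h.length ≤ B := by simp at hh; omega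
    have hX' (k) : (Function.update X a.1 (X a.1).tail k).length ≤ B := by
      by_cases hk : k = a.1
      · subst hk
        have := hX a.1
        rw [Function.update_self, List.length_tail]
        omega
      · rw [Function.update_of_ne hk]
        exact hX k
    by_cases ha : (X a.1).head? = some a.2
    · rw [if_pos ha] at h₂
      simp only [h₃, ha, true_and]
      exact (ReachesWithin.head h₁ (.head h₂ (ih _ hlen hX'))).mono (by simp; omega)
    · rw [if_neg ha] at h₂
      simp only [h₃, ha, false_and, decide_false]
      exact (ReachesWithin.head h₁ (.head h₂
        (reaches_clean inj yes B _ (hB _ _ hlen hX') false))).mono (by simp; omega)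

/-- Parsing, loading and comparing cost two steps per symbol each, cleaning up costs one; hence the
factor `7`. The constant absorbs the four initial tokens and the growth `maxPush` of the simulated
step. -/
theorem reaches_judgeHalt (w : List (Option Bool)) :
    ReachesWithin (TM2.step (judgeProgram inj yes)) (7 * w.length + (maxPush tm + 40))
      (judgeCfg .start w [] [] fun _ => [])
      (judgeHalt (tokenVerdict (parseOut inj .question w (startTokens yes)))) := by
  have h₁ : TM2.step (judgeProgram inj yes) (judgeCfg .start w [] [] fun _ => []) =
      some (judgeCfg (.parse .question) w (startTokens yes) [] fun _ => []) := by
    simp only [judgeCfg, TM2.step, judgeProgram, TM2.stepAux, update_rev]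
    rfl
  set r := parseOut inj .question w (startTokens yes) with hr
  have hlen : r.length ≤ w.length + 4 := length_parseOut_le inj .question w (startTokens yes)
  obtain ⟨hX, hh⟩ := length_loadOut_le ((false, false), none) r (fun _ => []) []
  have h₂ := reaches_compare inj yes (w.length + 4 + maxPush tm) _
    (pointStep (loadOut ((false, false), none) r (fun _ => []) []).1)
    (hh.trans (by simp; omega)) fun k => (length_pointStep_le _ k).trans <| by
      have := hX k
      simp only [List.length_nil] at this
      omega
  refine ((ReachesWithin.head h₁ (reaches_parse ..)).trans <| (reaches_load ..).trans <|
    (reaches_simulate ..).trans h₂).mono ?_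
  simp only [List.length_nil] at hh
  rw [← hr]
  omega

end Semantics

/-! ### The judge is computed in polynomial time -/

section Judge

variable {tm : FinTM2} [∀ k, Finite (tm.Γ k)] (inj : Bool → tm.Γ tm.k₀) (yes : tm.Γ tm.k₁)

/-- The judge, as a function. -/
noncomputable def judge (q : List Bool) (xs : List (List Bool)) : Bool :=
  tokenVerdict (parseOut inj .question (encodeTranscript (q, xs)) (startTokens yes))

theorem initList_judgeTM (w : List (Option Bool)) :
    initList (judgeTM inj yes) w = judgeCfg .start w [] [] fun _ => [] := by
  unfold initList judgeCfg
  congr 1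
  funext k
  cases k
  case inp => exact dif_pos rfl
  all_goals exact dif_neg (by simp [judgeTM])

theorem haltList_judgeTM (b : Bool) : haltList (judgeTM inj yes) [b] = judgeHalt b := by
  unfold haltList judgeHalt
  congr 1
  funext k
  cases k
  case out => exact dif_pos rfl
  all_goals exact dif_neg (by simp [judgeTM])

theorem isPolyTimeJudge_judge : IsPolyTimeJudge (judge inj yes) := by
  have h (t : List Bool × List (List Bool)) :=
    reaches_judgeHalt inj yes (encodeTranscript t)
  choose n hn h using h
  refine ⟨⟨⟨judgeTM inj yes, Equiv.refl _, Equiv.refl _⟩,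
    7 * Polynomial.X + Polynomial.C (maxPush tm + 40), fun t => ⟨⟨n t, ?_⟩, ?_⟩⟩, ?_⟩
  · have h₁ := initList_judgeTM inj yes (encodeTranscript t)
    have h₂ := haltList_judgeTM inj yes (judge inj yes t.1 t.2)
    have h₃ := h t
    rw [← h₁] at h₃
    refine Eq.trans ?_ (h₃.trans (congrArg some h₂.symm))
    congr 3
    exact List.map_id _
  · simpa using hn t
  · intro k
    have := finite_pointSymbol (tm := tm)
    change Finite (JudgeSymbol tm k)
    cases k <;> simp only [JudgeSymbol] <;> infer_instance

end Judge

/-! ### Determinacy of finite games -/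

section Games

theorem alternating_congr {α : Type} (b : Bool) (n : ℕ) {P Q : List α → Prop}
    (h : ∀ l : List α, l.length = n → (P l ↔ Q l)) : Alternating b n P ↔ Alternating b n Q := by
  induction n generalizing b P Q with
  | zero => cases b <;> exact h [] rfl
  | succ n ih =>
    cases b
    · exact forall_congr' fun x => ih _ fun l hl => h _ (by simp [hl])
    · exact exists_congr fun x => ih _ fun l hl => h _ (by simp [hl])

theorem length_play {m : ℕ} (σ τ : Strategy m) (i : ℕ) : (play σ τ i).length = i := by
  induction i with
  | zero => rfl
  | succ i ih => simp [play, ih]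

/-- After the first `i` of `n` moves `p`, the first player can enforce `P`. -/
def WinningAfter {α : Type} (P : List α → Prop) (n i : ℕ) (p : List α) : Prop :=
  Alternating (decide (Even i)) (n - i) fun l => P (p ++ l)

section

variable {α : Type} {P : List α → Prop} {n i : ℕ} {p : List α}

theorem winningAfter_of_even (hi : i < n) (h : Even i) :
    WinningAfter P n i p ↔ ∃ x, WinningAfter P n (i + 1) (p ++ [x]) := by
  obtain ⟨k, rfl⟩ := Nat.exists_eq_add_of_lt hi
  have h' : ¬ Even (i + 1) := by simpa [Nat.even_add_one] using h
  simp only [WinningAfter, h, h', decide_true, decide_false, Nat.add_assoc, Nat.add_sub_cancel_left,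
    show i + (k + 1) - (i + 1) = k by omega, Alternating, List.append_assoc, List.cons_append,
    List.nil_append]

theorem winningAfter_of_odd (hi : i < n) (h : ¬ Even i) :
    WinningAfter P n i p ↔ ∀ x, WinningAfter P n (i + 1) (p ++ [x]) := by
  obtain ⟨k, rfl⟩ := Nat.exists_eq_add_of_lt hi
  have h' : Even (i + 1) := by simpa [Nat.even_add_one] using h
  simp only [WinningAfter, h, h', decide_true, decide_false, Nat.add_assoc, Nat.add_sub_cancel_left,
    show i + (k + 1) - (i + 1) = k by omega, Alternating, List.append_assoc, List.cons_append,
    List.nil_append]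

theorem winningAfter_self : WinningAfter P n n p ↔ P p := by
  simp [WinningAfter, Alternating]

end

/-- Alice always moves so that `WinningAfter` persists. The default move never occurs in the first
`n` moves of a play following this strategy. -/
theorem exists_winning_strategy {m n : ℕ} {P : List (Move m) → Prop} (h : Alternating true n P) :
    ∃ σ : Strategy m, ∀ τ, P (play σ τ n) := by
  classical
  let σ : Strategy m := fun p =>
    if h : ∃ x, WinningAfter P n (p.length + 1) (p ++ [x]) then h.choose else ⟨[], by simp⟩
  refine ⟨σ, fun τ => ?_⟩
  have key : ∀ i ≤ n, WinningAfter P n i (play σ τ i) := by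
    intro i
    induction i with
    | zero => intro _; simpa [WinningAfter, play] using h
    | succ i ih =>
      intro hi
      have ih := ih (by omega)
      by_cases he : Even i
      · have hex := (winningAfter_of_even hi he).1 ih
        rw [play, if_pos he]
        have hσ : σ (play σ τ i) = hex.choose := by
          simp only [σ, length_play, dif_pos hex]
        rw [hσ]
        exact hex.choose_spec
      · exact (winningAfter_of_odd hi he).1 ih _
  exact winningAfter_self.1 (key n le_rfl)

theorem exists_refuting_strategy {m n : ℕ} {P : List (Move m) → Prop}
    (h : ¬ Alternating true n P) : ∃ τ : Strategy m, ∀ σ, ¬ P (play σ τ n) := by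
  classical
  let τ : Strategy m := fun p =>
    if h : ∃ x, ¬ WinningAfter P n (p.length + 1) (p ++ [x]) then h.choose else ⟨[], by simp⟩
  refine ⟨τ, fun σ => ?_⟩
  have key : ∀ i ≤ n, ¬ WinningAfter P n i (play σ τ i) := by
    intro i
    induction i with
    | zero => intro _; simpa [WinningAfter, play] using h
    | succ i ih =>
      intro hi
      have ih := ih (by omega)
      by_cases he : Even i
      · exact not_exists.1 (mt (winningAfter_of_even hi he).2 ih) _
      · have hex := not_forall.1 (mt (winningAfter_of_odd hi he).2 ih)
        rw [play, if_neg he]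
        have hτ : τ (play σ τ i) = hex.choose := by
          simp only [τ, length_play, dif_pos hex]
        rw [hτ]
        exact hex.choose_spec
  exact mt winningAfter_self.2 (key n le_rfl)

theorem exists_isOptimalPlay (H : List Bool → List (List Bool) → Bool) (q : List Bool) (n m : ℕ) :
    ∃ σ τ : Strategy m, IsOptimalPlay H q n σ τ := by
  by_cases h : Alternating true n fun l : List (Move m) => verdict H q l = true
  · obtain ⟨σ, hσ⟩ := exists_winning_strategy h
    -- The losing side may play anything, so the same function serves for both players.
    exact ⟨σ, σ, fun _ _ => hσ σ, fun τ' hτ' => by simp [hσ τ'] at hτ'⟩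
  · obtain ⟨τ, hτ⟩ := exists_refuting_strategy h
    exact ⟨τ, τ, fun σ' hσ' => absurd hσ' (hτ σ'), fun _ _ => by simpa using hτ τ⟩

/-- By determinacy one player has a winning strategy; in an equilibrium that player already wins,
since switching to it would repair a loss. -/
theorem IsOptimalPlay.verdict_eq_true_iff {H : List Bool → List (List Bool) → Bool} {q : List Bool}
    {n m : ℕ} {σ τ : Strategy m} (h : IsOptimalPlay H q n σ τ) :
    verdict H q (play σ τ n) = true ↔
      Alternating true n fun l : List (Move m) => verdict H q l = true := by
  constructor
  · intro hv
    by_contra hn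
    obtain ⟨τ', hτ'⟩ := exists_refuting_strategy hn
    have := h.2 τ' (by simpa using hτ' σ)
    simp [hv] at this
  · intro ha
    obtain ⟨σ', hσ'⟩ := exists_winning_strategy ha
    exact h.1 σ' (hσ' τ)

end Games

/-! ### Statements as descriptions of configurations -/

section Coding

variable {tm : FinTM2}

theorem pushItems_append (l l' : List (Item tm)) (X : Point tm) :
    pushItems (l ++ l') X = pushItems l (pushItems l' X) :=
  List.foldr_append

theorem pushItems_map (k : tm.K) (l : List (tm.Γ k)) (X : Point tm) :
    pushItems (l.map fun y => (⟨some k, y⟩ : Item tm)) X =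
      Function.update X (some k) (l ++ X (some k)) := by
  induction l with
  | nil => simp [pushItems]
  | cons y l ih =>
    change pushItem _ (pushItems _ X) = _
    rw [ih]
    simp [pushItem]

theorem pushItems_flatMap (ks : List tm.K) (hks : ks.Nodup) (S : ∀ k, List (tm.Γ k)) :
    pushItems (ks.flatMap fun k => (S k).map fun y => (⟨some k, y⟩ : Item tm)) (fun _ => []) =
      Point.mk [] fun k => if k ∈ ks then S k else [] := by
  induction ks with
  | nil => funext k; cases k <;> simp [pushItems, Point.mk]
  | cons k ks ih =>
    obtain ⟨hk, hks⟩ := List.nodup_cons.1 hks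
    rw [List.flatMap_cons, pushItems_append, ih hks, pushItems_map, update_mk_some]
    congr 1
    funext k'
    by_cases h : k' = k
    · subst h
      simp [Point.mk, hk]
    · simp [h]

/-- The items of a configuration. -/
noncomputable def cfgItems (c : tm.Cfg) : List (Item tm) :=
  letI := tm.kFin
  ⟨none, (TM2.Cfg.l c, TM2.Cfg.var c)⟩ :: (Finset.univ : Finset tm.K).toList.flatMap fun k =>
    (TM2.Cfg.stk c k).map fun y => (⟨some k, y⟩ : Item tm)

theorem ofItems_cfgItems (c : tm.Cfg) : ofItems (cfgItems c) = toPoint c := by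
  let _ := tm.kFin
  change pushItem _ (pushItems _ _) = _
  rw [pushItems_flatMap _ (Finset.nodup_toList _)]
  simp only [pushItem, update_mk_none, toPoint]
  simp [Point.mk]

theorem length_cfgItems (c : tm.Cfg) : (cfgItems c).length = cfgSpace tm c + 1 := by
  let _ := tm.kFin
  simp only [cfgItems, cfgSpace, List.length_cons, List.length_flatMap, List.length_map]
  rw [Finset.sum_map_toList]

variable [∀ k, Finite (tm.Γ k)]

/-- The items described by a statement of Alice, parsed after `j` bits `true`. -/
noncomputable def statementItems : Fin (Nat.card (Item tm)) → List Bool → List (Item tm)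
  | _, [] => []
  | j, true :: x => statementItems (j + 1) x
  | j, false :: x => (Finite.equivFin (Item tm)).symm j :: statementItems 0 x

/-- The point described by a statement of Alice. -/
noncomputable def statementPoint (x : List Bool) : Point tm :=
  ofItems (statementItems 0 x)

/-- The statement describing a list of items. -/
noncomputable def encodeItems (l : List (Item tm)) : List Bool :=
  l.flatMap fun a => List.replicate (Finite.equivFin (Item tm) a) true ++ [false]

/-- The unary counter lives in `Fin` and wraps around, so no bit string is malformed. -/
theorem statementItems_replicate (j : Fin (Nat.card (Item tm))) (n : ℕ) (x : List Bool) :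
    statementItems j (List.replicate n true ++ x) =
      statementItems (j + Fin.ofNat (Nat.card (Item tm)) n) x := by
  induction n generalizing j with
  | zero => congr 1; simp
  | succ n ih =>
    rw [List.replicate_succ, List.cons_append, statementItems, ih]
    congr 1
    ext
    simp [Fin.val_add, Nat.add_assoc, Nat.add_comm n 1]

theorem statementItems_encodeItems (l : List (Item tm)) :
    statementItems 0 (encodeItems l) = l := by
  induction l with
  | nil => rfl
  | cons a l ih =>
    rw [encodeItems, List.flatMap_cons, List.append_assoc, statementItems_replicate,
      List.cons_append, List.nil_append, statementItems]
    rw [encodeItems] at ih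
    rw [ih]
    congr 1
    rw [Equiv.symm_apply_eq]
    simp

/-- An index is smaller than the number of items, so with its closing `false` each item takes at
most that many bits. -/
theorem length_encodeItems_le (l : List (Item tm)) :
    (encodeItems l).length ≤ Nat.card (Item tm) * l.length := by
  induction l with
  | nil => simp [encodeItems]
  | cons a l ih =>
    rw [encodeItems, List.flatMap_cons]
    rw [encodeItems] at ih
    have := (Finite.equivFin (Item tm) a).isLt
    simp only [List.length_append, List.length_replicate, List.length_cons, List.length_nil,
      Nat.mul_add]
    omega

theorem statementPoint_encode_cfgItems (c : tm.Cfg) :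
    statementPoint (encodeItems (cfgItems c)) = toPoint c := by
  rw [statementPoint, statementItems_encodeItems, ofItems_cfgItems]

theorem length_encode_cfgItems_le (c : tm.Cfg) :
    (encodeItems (cfgItems c)).length ≤ Nat.card (Item tm) * (cfgSpace tm c + 1) :=
  (length_encodeItems_le _).trans_eq (by rw [length_cfgItems])

end Coding

/-! ### The transcript seen by the judge -/

section Transcript

variable {tm : FinTM2}

/-- Loading the tokens `r` yields the items `lo` on the simulation stacks and the items `hi` on the
stack for the second configuration, unless such blocks have been found earlier. -/
def LoadsAs (r : List (Token tm)) (lo hi : List (Item tm)) : Prop :=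
  ∀ s t o X h, loadOut ((s, t), o) r X h =
    (if s then X else pushItems lo X, if t then h else hi ++ h)

/-- The last item of a block lies on top of the transcript stack and is loaded first, matching the
order of `pushItems`. -/
theorem loadOut_append (g : LoadState) (l : List (Item tm)) (r : List (Token tm)) (X : Point tm)
    (h : List (Item tm)) :
    loadOut g (l.reverse.map .inl ++ r) X h =
      loadOut g r (if g.2 = some true then pushItems l X else X)
        (if g.2 = some false then l ++ h else h) := by
  induction l using List.reverseRecOn generalizing X h with
  | nil => simp [pushItems]
  | append_singleton l a ih =>
    rw [List.reverse_append, List.reverse_singleton, List.singleton_append, List.map_cons,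
      List.cons_append]
    rcases g with ⟨p, _ | _ | _⟩ <;> rw [loadOut, ih] <;> simp [pushItems]

theorem loadsAs_nil : LoadsAs (tm := tm) [] [] [] := by
  intro s t o X h
  cases s <;> cases t <;> simp [loadOut, pushItems]

/-- The newest block with mark `b` is met first and sets its flag, so it shadows older blocks with
that mark and leaves the other endpoint alone. Thus Bob's bit replaces one endpoint. -/
theorem LoadsAs.cons {r : List (Token tm)} {lo hi : List (Item tm)} (hr : LoadsAs r lo hi)
    (b : Bool) (l : List (Item tm)) :
    LoadsAs (.inr b :: (l.reverse.map .inl ++ r)) (if b then l else lo) (if b then hi else l) := by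
  intro s t o X h
  have h₁ (g : LoadState) (b : Bool) (r : List (Token tm)) :
    loadOut g (.inr b :: r) X h = loadOut (g.mark b) r X h := by simp [loadOut]
  rw [h₁, loadOut_append]
  cases b <;> cases s <;> cases t <;> simp [LoadState.mark] <;> rw [hr] <;> simp

-- Here `l` stands for the last statement: unanswered, it carries no mark, and the loader discards
-- it.
open Classical in
theorem tokenVerdict_eq_true_iff {r : List (Token tm)} {lo hi : List (Item tm)}
    (hr : LoadsAs r lo hi) (l : List (Item tm)) :
    tokenVerdict (l.reverse.map .inl ++ r) = true ↔ ofItems hi = pointStep (ofItems lo) := by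
  have h : loadOut ((false, false), none) (l.reverse.map .inl ++ r) (fun _ => []) [] =
      (ofItems lo, hi) := by
    rw [loadOut_append, hr]
    simp [ofItems]
  rw [tokenVerdict, h, decide_eq_true_iff]

variable [∀ k, Finite (tm.Γ k)] (inj : Bool → tm.Γ tm.k₀)

theorem parseOut_question (q : List Bool) (w : List (Option Bool)) (r : List (Token tm)) :
    parseOut inj .question (q.map some ++ w) r = parseOut inj .question w
      ((q.map fun b => (⟨some tm.k₀, inj b⟩ : Item tm)).reverse.map .inl ++ r) := by
  induction q generalizing r with
  | nil => rfl
  | cons b q ih =>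
    rw [List.map_cons, List.cons_append, parseOut]
    refine (ih _).trans ?_
    simp [parseStep]

/-- Trailing bits `true` leave some counter value `j'`, which is ignored by the separator or end of
input that follows. -/
theorem parseOut_alice (j : Fin (Nat.card (Item tm))) (x : List Bool) (w : List (Option Bool))
    (r : List (Token tm)) :
    ∃ j', parseOut inj (.alice j) (x.map some ++ w) r =
      parseOut inj (.alice j') w ((statementItems j x).reverse.map .inl ++ r) := by
  induction x generalizing j r with
  | nil => exact ⟨j, rfl⟩
  | cons b x ih =>
    rw [List.map_cons, List.cons_append, parseOut]
    cases b
    · obtain ⟨j', h⟩ := ih 0 (.inl ((Finite.equivFin (Item tm)).symm j) :: r)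
      refine ⟨j', h.trans ?_⟩
      simp [statementItems]
    · exact ih (j + 1) r

theorem parseOut_bob (c : Bool) (y : List Bool) (w : List (Option Bool)) (r : List (Token tm)) :
    parseOut inj (.bob c) (y.map some ++ w) r = parseOut inj (.bob (y.getLastD c)) w r := by
  induction y generalizing c with
  | nil => rfl
  | cons b y ih =>
    rw [List.map_cons, List.cons_append, parseOut, List.getLastD_cons]
    exact ih b

/-- The statements of a debate, without the first separator. -/
def debateWord : List (List Bool) → List (Option Bool)
  | [] => []
  | x :: xs => x.map some ++ xs.flatMap fun x => none :: x.map some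

theorem flatMap_eq_cons_debateWord {xs : List (List Bool)} (h : xs ≠ []) :
    (xs.flatMap fun x => none :: x.map some) = none :: debateWord xs := by
  cases xs with
  | nil => exact absurd rfl h
  | cons x xs => simp [debateWord]

theorem tokenVerdict_singleton {r : List (Token tm)} {lo hi : List (Item tm)}
    (hr : LoadsAs r lo hi) (x : List Bool) :
    tokenVerdict (parseOut inj (.alice 0) (debateWord [x]) r) = true ↔
      pointStep (ofItems lo) = ofItems hi := by
  obtain ⟨j', h⟩ := parseOut_alice inj 0 x [] r
  rw [debateWord, List.flatMap_nil, h, parseOut, tokenVerdict_eq_true_iff hr, eq_comm]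

/-- Bob's mark is written at the separator after `y`, which exists because `xs` is nonempty. -/
theorem parseOut_cons_cons (r : List (Token tm)) (x y : List Bool) {xs : List (List Bool)}
    (hxs : xs ≠ []) :
    parseOut inj (.alice 0) (debateWord (x :: y :: xs)) r =
      parseOut inj (.alice 0) (debateWord xs)
        (.inr (y.getLastD false) :: ((statementItems 0 x).reverse.map .inl ++ r)) := by
  rw [debateWord, List.flatMap_cons, flatMap_eq_cons_debateWord hxs]
  obtain ⟨j', h⟩ := parseOut_alice inj 0 x
    (none :: y.map some ++ none :: debateWord xs) r
  rw [h, List.cons_append, parseOut]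
  simp only [parseStep]
  rw [parseOut_bob, parseOut]
  rfl

end Transcript

/-! ### The game of halving the computation -/

section Halving

variable {tm : FinTM2} [∀ k, Finite (tm.Γ k)] (inj : Bool → tm.Γ tm.k₀)

/-- Alice wins the debate `l`, if it starts with the tokens `r`. -/
def AliceWins (r : List (Token tm)) {m : ℕ} (l : List (Move m)) : Prop :=
  tokenVerdict (parseOut inj (.alice 0) (debateWord (l.map Subtype.val)) r) = true

theorem alternating_aliceWins_succ (r : List (Token tm)) (m T : ℕ) :
    Alternating true (2 * (T + 1) + 1) (AliceWins inj r (m := m)) ↔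
      ∃ x : Move m, ∀ y : Move m, Alternating true (2 * T + 1) (AliceWins inj
        (.inr (y.1.getLastD false) :: ((statementItems 0 x.1).reverse.map .inl ++ r)) (m := m)) := by
  refine exists_congr fun x => forall_congr' fun y => alternating_congr _ _ fun l hl => ?_
  have h : l.map Subtype.val ≠ [] := fun h => by simp [List.map_eq_nil_iff.1 h] at hl
  simp only [AliceWins, List.map_cons, parseOut_cons_cons inj r x.1 y.1 h]

/-- Alice's midpoint must survive both answers of Bob, and the two resulting halves compose. The
bound `1 ≤ m` allows Bob to answer `[true]`. -/
theorem iterate_eq_of_alternating {m : ℕ} (hm : 1 ≤ m) (T : ℕ) {r : List (Token tm)}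
    {lo hi : List (Item tm)} (hr : LoadsAs r lo hi)
    (h : Alternating true (2 * T + 1) (AliceWins inj r (m := m))) :
    pointStep^[2 ^ T] (ofItems lo) = ofItems hi := by
  induction T generalizing r lo hi with
  | zero =>
    obtain ⟨x, hx⟩ := h
    exact (tokenVerdict_singleton inj hr x.1).1 hx
  | succ T ih =>
    obtain ⟨x, hx⟩ := (alternating_aliceWins_succ inj r m T).1 h
    have h₁ := ih (hr.cons _ _) (hx ⟨[true], hm⟩)
    have h₂ := ih (hr.cons _ _) (hx ⟨[], Nat.zero_le _⟩)
    simp only [List.getLastD_cons, List.getLastD_nil, if_true] at h₁ h₂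
    simp only [Bool.false_eq_true, if_false] at h₂
    rw [pow_succ, mul_two, Function.iterate_add_apply, h₂, h₁]

/-- Alice names the true midpoint. The hypothesis `hlo` passes to both halves, since iterates of the
midpoint are later iterates of `lo`. -/
theorem alternating_of_iterate_eq {m : ℕ} (T : ℕ) {r : List (Token tm)}
    {lo hi : List (Item tm)} (hr : LoadsAs r lo hi)
    (hlo : ∀ i, ∃ x : Move m, statementPoint x.1 = pointStep^[i] (ofItems lo))
    (h : pointStep^[2 ^ T] (ofItems lo) = ofItems hi) :
    Alternating true (2 * T + 1) (AliceWins inj r (m := m)) := by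
  induction T generalizing r lo hi with
  -- The final statement does not affect the verdict.
  | zero => exact ⟨⟨[], Nat.zero_le _⟩, (tokenVerdict_singleton inj hr []).2 h⟩
  | succ T ih =>
    obtain ⟨x, hx⟩ := hlo (2 ^ T)
    refine (alternating_aliceWins_succ inj r m T).2 ⟨x, fun y => ?_⟩
    refine ih (hr.cons _ _) ?_ ?_
    · cases y.1.getLastD false
      · exact hlo
      · intro i
        obtain ⟨z, hz⟩ := hlo (i + 2 ^ T)
        refine ⟨z, hz.trans ?_⟩
        rw [Function.iterate_add_apply, ← hx]
        rfl
    · cases y.1.getLastD false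
      · exact hx.symm
      · rw [pow_succ, mul_two, Function.iterate_add_apply, ← hx] at h
        exact h

end Halving

/-! ### Bounding the running time by the number of configurations -/

section Orbits

/-- Up to the first visit to the fixed point `b` the orbit has no repetition, so `g` is injective on
it and that visit happens before time `N`. -/
theorem iterate_eq_of_card_le {α : Type*} {f : α → α} {a b : α} (hb : f b = b) {n : ℕ}
    (hn : f^[n] a = b) {N : ℕ} (g : α → Fin N)
    (hg : ∀ i j, g (f^[i] a) = g (f^[j] a) → f^[i] a = f^[j] a) : f^[N] a = b := by
  classical
  have hfix (i j : ℕ) (h : f^[i] a = b) : f^[j + i] a = b := by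
    rw [Function.iterate_add_apply, h, Function.iterate_fixed hb]
  have hex : ∃ n, f^[n] a = b := ⟨n, hn⟩
  suffices h : Nat.find hex < N by
    have := hfix _ (N - Nat.find hex) (Nat.find_spec hex)
    rwa [Nat.sub_add_cancel h.le] at this
  have hne (i j : ℕ) (hij : i < j) (hj : j ≤ Nat.find hex) : f^[i] a ≠ f^[j] a := by
    intro h
    -- Cutting out the loop between times `i` and `j` would reach `b` earlier.
    refine Nat.find_min hex (m := Nat.find hex - j + i) (by omega) ?_
    rw [Function.iterate_add_apply, h, ← Function.iterate_add_apply, Nat.sub_add_cancel hj]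
    exact Nat.find_spec hex
  have hinj : Function.Injective fun i : Fin (Nat.find hex + 1) => g (f^[i] a) := by
    intro i j h
    have h := hg _ _ h
    rcases lt_trichotomy i j with hij | hij | hij
    · exact absurd h (hne i j hij (by omega))
    · exact hij
    · exact absurd h.symm (hne j i hij (by omega))
  have := Fintype.card_le_of_injective _ hinj
  simp only [Fintype.card_fin] at this
  omega

/-- A number coding a bit string. -/
def bitsCode : List Bool → ℕ
  | [] => 1
  | b :: l => 2 * bitsCode l + b.toNat

theorem bitsCode_pos (l : List Bool) : 0 < bitsCode l := by
  induction l with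
  | nil => exact one_pos
  | cons b l ih => rw [bitsCode]; omega

/-- The value `1` on the empty string acts as a leading binary digit: strings of different lengths
get different codes, and those of length at most `m` stay below `2^(m+1)`. -/
theorem bitsCode_lt (l : List Bool) : bitsCode l < 2 ^ (l.length + 1) := by
  induction l with
  | nil => simp [bitsCode]
  | cons b l ih =>
    have := Bool.toNat_le b
    rw [bitsCode, List.length_cons, pow_succ]
    omega

theorem bitsCode_injective : Function.Injective bitsCode := by
  intro l
  induction l with
  | nil =>
    rintro (_ | ⟨b, l⟩) h
    · rfl
    · have := bitsCode_pos l
      simp only [bitsCode] at h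
      omega
  | cons b l ih =>
    rintro (_ | ⟨b', l'⟩) h
    · have := bitsCode_pos l
      simp only [bitsCode] at h
      omega
    · simp only [bitsCode] at h
      have h₁ := Bool.toNat_le b
      have h₂ := Bool.toNat_le b'
      rw [ih (show bitsCode l = bitsCode l' by omega)]
      congr 1
      have h₃ : b.toNat = b'.toNat := by omega
      cases b <;> cases b' <;> simp_all

/-- `none` is absorbing, so a run that ends in `some b` never meets it, and the default is never
used. -/
theorem iterate_getD_of_evalsTo {α : Type*} {f : α → Option α} {a b : α}
    (h : EvalsTo f a (some b)) : (fun c => (f c).getD c)^[h.steps] a = b := by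
  obtain ⟨n, h⟩ := h
  change (fun c => (f c).getD c)^[n] a = b
  have hnone (n : ℕ) : (flip bind f)^[n] none = none := by
    induction n with
    | zero => rfl
    | succ n ih => rw [Function.iterate_succ_apply]; exact ih
  induction n generalizing a with
  | zero => exact Option.some.inj h
  | succ n ih =>
    rw [Function.iterate_succ_apply] at h ⊢
    change (flip bind f)^[n] (f a) = some b at h
    rcases hfa : f a with _ | c
    · rw [hfa, hnone] at h
      cases h
    · rw [hfa] at h
      exact ih h

theorem reaches_iterate_getD {α : Type*} (f : α → Option α) (a : α) (n : ℕ) :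
    Reaches f a ((fun c => (f c).getD c)^[n] a) := by
  induction n with
  | zero => exact .refl
  | succ n ih =>
    rw [Function.iterate_succ_apply']
    set c := (fun c => (f c).getD c)^[n] a
    rcases hc : f c with _ | d
    · exact ih
    · rw [Option.getD_some]
      exact Relation.ReflTransGen.tail ih hc

end Orbits

/-! ### The main theorem -/

section Main

variable {tm : FinTM2}

theorem toPoint_initList (s : List (tm.Γ tm.k₀)) :
    toPoint (initList tm s) =
      ofItems (initItem tm :: s.map fun y => (⟨some tm.k₀, y⟩ : Item tm)) := by
  change _ = pushItem _ (pushItems _ _)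
  rw [pushItems_map]
  funext k
  rcases k with _ | k
  · simp [toPoint, Point.mk, pushItem, initItem, initList]
  · by_cases h : k = tm.k₀
    · subst h
      simp [toPoint, Point.mk, pushItem, initItem, initList]
    · simp [toPoint, Point.mk, pushItem, initItem, initList, h]

theorem toPoint_haltList (y : tm.Γ tm.k₁) :
    toPoint (haltList tm [y]) = ofItems (acceptItems y) := by
  change _ = pushItem _ (pushItem _ _)
  funext k
  rcases k with _ | k
  · simp [toPoint, Point.mk, pushItem, haltList]
  · by_cases h : k = tm.k₁
    · subst h
      simp [toPoint, Point.mk, pushItem, haltList]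
    · simp [toPoint, Point.mk, pushItem, haltList, h]

theorem iterate_pointStep_toPoint (c : tm.Cfg) (n : ℕ) :
    pointStep^[n] (toPoint c) = toPoint ((fun c => (tm.step c).getD c)^[n] c) := by
  induction n generalizing c with
  | zero => rfl
  | succ n ih => rw [Function.iterate_succ_apply, pointStep_toPoint, ih]; rfl

theorem haltList_injective (y y' : tm.Γ tm.k₁) (h : haltList tm [y] = haltList tm [y']) :
    y = y' := by
  have := congrFun (congrArg TM2.Cfg.stk h) tm.k₁
  simpa [haltList] using this

/-- The tokens on the transcript stack when the first statement begins. -/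
def questionTokens (inj : Bool → tm.Γ tm.k₀) (yes : tm.Γ tm.k₁) (q : List Bool) :
    List (Token tm) :=
  .inr true :: ((initItem tm :: (q.map inj).map fun y => (⟨some tm.k₀, y⟩ : Item tm)).reverse.map
    .inl ++ (.inr false :: ((acceptItems yes).reverse.map .inl ++ [])))

theorem loadsAs_questionTokens (inj : Bool → tm.Γ tm.k₀) (yes : tm.Γ tm.k₁) (q : List Bool) :
    LoadsAs (questionTokens inj yes q)
      (initItem tm :: (q.map inj).map fun y => (⟨some tm.k₀, y⟩ : Item tm)) (acceptItems yes) :=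
  (loadsAs_nil.cons false (acceptItems yes)).cons true _

variable [∀ k, Finite (tm.Γ k)]

theorem iterate_step_eq_of_evalsTo {c d : tm.Cfg} (h : EvalsTo tm.step c (some d))
    (hd : tm.step d = none) {s : ℕ} (hs : ∀ e, Reaches tm.step c e → cfgSpace tm e ≤ s) {m : ℕ}
    (hm : m = Nat.card (Item tm) * (s + 1)) :
    (fun c => (tm.step c).getD c)^[2 ^ (m + 1)] c = d := by
  have hlen (i : ℕ) : (encodeItems (cfgItems ((fun c => (tm.step c).getD c)^[i] c))).length ≤ m :=
    (length_encode_cfgItems_le _).trans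
      (hm ▸ Nat.mul_le_mul_left _ (Nat.succ_le_succ (hs _ (reaches_iterate_getD _ _ i))))
  have hcode (i : ℕ) : bitsCode (encodeItems (cfgItems ((fun c => (tm.step c).getD c)^[i] c))) <
      2 ^ (m + 1) :=
    (bitsCode_lt _).trans_le (Nat.pow_le_pow_right two_pos (Nat.succ_le_succ (hlen i)))
  -- Reduction modulo `2^(m+1)` is harmless because injectivity is needed only along the orbit,
  -- where codes are smaller.
  refine iterate_eq_of_card_le (by simp only [hd]; rfl) (iterate_getD_of_evalsTo h)
    (fun e => Fin.ofNat (2 ^ (m + 1)) (bitsCode (encodeItems (cfgItems e)))) fun i j hij => ?_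
  have hij := congrArg Fin.val hij
  simp only [Fin.val_ofNat, Nat.mod_eq_of_lt (hcode _)] at hij
  refine toPoint_injective ?_
  rw [← statementPoint_encode_cfgItems, bitsCode_injective hij, statementPoint_encode_cfgItems]

/-- The first separator, present because `l` is nonempty, marks the initial configuration as left
endpoint. -/
theorem verdict_judge (inj : Bool → tm.Γ tm.k₀) (yes : tm.Γ tm.k₁) (q : List Bool) {m : ℕ}
    {l : List (Move m)} (hl : l ≠ []) :
    verdict (judge inj yes) q l = true ↔ AliceWins inj (questionTokens inj yes q) l := by
  have h : l.map Subtype.val ≠ [] := mt List.map_eq_nil_iff.1 hl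
  rw [verdict, judge, encodeTranscript, parseOut_question, flatMap_eq_cons_debateWord h, parseOut,
    AliceWins]
  simp [parseStep, questionTokens, startTokens, acceptItems, Function.comp_def]

end Main

end Debate

open Debate Turing StateTransition in
theorem Debate.exists_judge_of_inPSPACE {L : Language Bool} (hL : InPSPACE L) :
    ∃ (H : List Bool → List (List Bool) → Bool) (n m : Polynomial ℕ), IsPolyTimeJudge H ∧
      (∀ k : ℕ, Odd (n.eval k)) ∧
      ∀ q : List Bool, q ∈ L ↔ Alternating true (n.eval q.length)
        fun l : List (Move (m.eval q.length)) => verdict H q l = true := by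
  obtain ⟨f, M, s, hfin, hf, hs⟩ := hL
  have := hfin
  let inj := M.inputAlphabet.invFun
  let out := M.outputAlphabet.invFun
  let m : Polynomial ℕ := Polynomial.C (Nat.card (Item M.tm)) * (s + 1)
  have hm (k : ℕ) : m.eval k = Nat.card (Item M.tm) * (s.eval k + 1) := by simp [m]
  have hm_pos (k : ℕ) : 1 ≤ m.eval k := by
    rw [hm]
    exact Nat.mul_pos Nat.card_pos (Nat.succ_pos _)
  -- There are `m + 1` rounds of two statements to halve `2^(m+1)` steps, and one closing statement,
  -- which makes the number odd.
  refine ⟨judge inj (out true), 2 * (m + 1) + 1, m, isPolyTimeJudge_judge inj _, fun k => ?_,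
    fun q => ?_⟩
  · exact ⟨m.eval k + 1, by simp⟩
  have hn : (2 * (m + 1) + 1 : Polynomial ℕ).eval q.length = 2 * (m.eval q.length + 1) + 1 := by
    simp
  rw [hn, alternating_congr _ _ fun l hl => verdict_judge inj (out true) q
    (by rintro rfl; simp at hl)]
  have hload := loadsAs_questionTokens inj (out true) q
  have hiter := iterate_step_eq_of_evalsTo (M.outputsFun q) rfl (hs q) (hm q.length)
  have hpoint : pointStep^[2 ^ (m.eval q.length + 1)] (ofItems (initItem M.tm ::
      (q.map inj).map fun y => (⟨some M.tm.k₀, y⟩ : Item M.tm))) =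
      ofItems (acceptItems (out (f q))) := by
    rw [← toPoint_initList, iterate_pointStep_toPoint, hiter, ← toPoint_haltList]
    rfl
  rw [← hf]
  constructor
  · intro hq
    rw [hq] at hpoint
    refine alternating_of_iterate_eq inj _ hload (fun i => ?_) hpoint
    rw [← toPoint_initList, iterate_pointStep_toPoint]
    refine ⟨⟨_, (length_encode_cfgItems_le _).trans ?_⟩, statementPoint_encode_cfgItems _⟩
    rw [hm]
    exact Nat.mul_le_mul_left _ (Nat.succ_le_succ (hs q _ (reaches_iterate_getD _ _ i)))
  · intro hq
    have h := iterate_eq_of_alternating inj (hm_pos _) _ hload hq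
    -- The point reached is the halting configuration with output `f q`; it equals the accepting
    -- one, so the output symbols agree.
    rw [hpoint, ← toPoint_haltList, ← toPoint_haltList] at h
    exact M.outputAlphabet.symm.injective (haltList_injective _ _ (toPoint_injective h))

theorem mainTheorem1 (L : Language Bool) (hL : Debate.InPSPACE L) :
    ∃ (H : List Bool → List (List Bool) → Bool) (n m : Polynomial ℕ),
      Debate.IsPolyTimeJudge H ∧
      (∀ k : ℕ, Odd (n.eval k)) ∧
      ∀ q : List Bool,
        (q ∈ L ↔ Debate.Alternating true (n.eval q.length)
          fun l : List (Debate.Move (m.eval q.length)) => Debate.verdict H q l = true) ∧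
        (∃ σ τ : Debate.Strategy (m.eval q.length),
          Debate.IsOptimalPlay H q (n.eval q.length) σ τ) ∧
        ∀ σ τ : Debate.Strategy (m.eval q.length),
          Debate.IsOptimalPlay H q (n.eval q.length) σ τ →
            (Debate.verdict H q (Debate.play σ τ (n.eval q.length)) = true ↔ q ∈ L) := by
  obtain ⟨H, n, m, hH, hn, h⟩ := Debate.exists_judge_of_inPSPACE hL
  exact ⟨H, n, m, hH, hn, fun q => ⟨h q, Debate.exists_isOptimalPlay H q _ _,
    fun σ τ hστ => hστ.verdict_eq_true_iff.trans (h q).symm⟩⟩
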